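/- Let $\mathfrak H$ be a real or complex Hilbert space with norm $|\cdot|_2$, and let $\mathcal B(\mathfrak H)$ be the algebra of its bounded operators with the operator norm $\|\cdot\|_2$. Let $I\subset\mathbb R$ be an interval, and let $\phi$ be a countably additive $\mathcal B(\mathfrak H)$-valued Borel measure on $I$ without atoms (that is, $\phi(\{t\})=0$ for every $t\in I$) whose total variation $\int\|\phi\|_2$ is finite. Let \[\operatorname{Lexp}\phi=1+\sum_{n\ge 1}\ \int_{t_1\le\dots\le t_n\in I}\phi(t_n)\cdots\phi(t_1)\] be its left time-ordered exponential. For $x,y\in\mathfrak H$ with $x\ne0$ put \[y:x=\frac{\operatorname{Re}\langle y,x\rangle}{|x|_2^2}+\mathrm i\left|\frac{y}{|x|_2}-\frac{\operatorname{Re}\langle y,x\rangle}{|x|_2^2}\,\frac{x}{|x|_2}\right|_2 ,\] and for $A\in\mathcal B(\mathfrak H)$ let $\operatorname{CR}(A)=\{Ax:x,\ \overline{Ax:x}\ \mid\ x\in\mathfrak H\setminus\{0\}\}$ be its conformal range. If $\mathfrak H$ is real, spectra and spectral radii are taken in the complexification of $\mathcal B(\mathfrak H)$. Write $\overline{\mathrm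 D}(0,r)=\{z\in\mathbb C: |z|\le r\}$. Then \[\operatorname{CR}(\operatorname{Lexp}\phi)\subset\exp\overline{\mathrm D}\bigl(0,\textstyle\int\|\phi\|_2\bigr) \qquad\text{and}\qquad \operatorname{sp}(\operatorname{Lexp}\phi)\subset\exp\overline{\mathrm D}\bigl(0,\textstyle\int\|\phi\|_2\bigr).\] In particular, if $\int\|\phi\|_2<\pi$, then $\log\operatorname{Lexp}\phi$ is well-defined, and its spectral radius is at most $\int\|\phi\|_2$. Here $\log A$ is called well-defined if $(1-t)1+tA$ is invertible for every $t\in[0,1]$, and then \[\log A=\int_0^1 (A-1)\bigl(s+(1-s)A\bigr)^{-1}\,\mathrm ds .\] -/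

import Mathlib

open MeasureTheory Set
open scoped TensorProduct

noncomputable section

/-- The total variation `∫ ‖φ‖ ∈ [0, ∞]` of a measure with values in a normed ring. -/
def totalVariation {α 𝔄 : Type*} [MeasurableSpace α] [NormedRing 𝔄] (φ : VectorMeasure α 𝔄) :
    ENNReal :=
  φ.variation univ

/-- The iterated ordered integrals
`lexpTerm φ n t = ∫_{t₁ ≤ ⋯ ≤ tₙ ≤ t} φ(tₙ) ⋯ φ(t₁)` of an `𝔄`-valued measure `φ` on an ordered
space (later factors stand on the left), computed one variable at a time:
`lexpTerm φ 0 t = 1` and `lexpTerm φ (n + 1) t = ∫_{s ≤ t} φ(ds) (lexpTerm φ n s)`. -/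
def lexpTerm {α 𝔄 : Type*} [Preorder α] [MeasurableSpace α] [NormedRing 𝔄] [NormedAlgebra ℝ 𝔄]
    (φ : VectorMeasure α 𝔄) : ℕ → α → 𝔄
  | 0 => fun _ => 1
  | n + 1 => fun t =>
      (φ.restrict (Iic t)).integral (lexpTerm φ n) (ContinuousLinearMap.mul ℝ 𝔄).flip

/-- The left time-ordered exponential
`Lexp φ = 1 + ∑_{n ≥ 1} ∫_{t₁ ≤ ⋯ ≤ tₙ} φ(tₙ) ⋯ φ(t₁)`. -/
def Lexp {α 𝔄 : Type*} [Preorder α] [MeasurableSpace α] [NormedRing 𝔄] [NormedAlgebra ℝ 𝔄]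
    (φ : VectorMeasure α 𝔄) : 𝔄 :=
  1 + ∑' n : ℕ, φ.integral (lexpTerm φ n) (ContinuousLinearMap.mul ℝ 𝔄).flip

/-- The complex number `y : x` recording the real orthogonal decomposition of `y` with respect to
`x ≠ 0`: its real part is `Re⟪y, x⟫ / ‖x‖²`, its imaginary part is
`‖ y / ‖x‖ - (Re⟪y, x⟫ / ‖x‖²) x / ‖x‖ ‖`. -/
def conformalQuot (𝕜 : Type*) {H : Type*} [RCLike 𝕜] [NormedAddCommGroup H]
    [InnerProductSpace 𝕜 H] (y x : H) : ℂ where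
  re := RCLike.re (inner 𝕜 y x) / ‖x‖ ^ 2
  im := ‖((‖x‖⁻¹ : ℝ) : 𝕜) • y
      - ((RCLike.re (inner 𝕜 y x) / ‖x‖ ^ 2 : ℝ) : 𝕜) • ((‖x‖⁻¹ : ℝ) : 𝕜) • x‖

/-- The conformal range of a bounded operator on a real or complex Hilbert space. -/
def conformalRange {𝕜 H : Type*} [RCLike 𝕜] [NormedAddCommGroup H] [InnerProductSpace 𝕜 H]
    (A : H →L[𝕜] H) : Set ℂ :=
  {z | ∃ x : H, x ≠ 0 ∧
    (z = conformalQuot 𝕜 (A x) x ∨ z = starRingEnd ℂ (conformalQuot 𝕜 (A x) x))}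

/-- `log A` is well-defined: the segment from `1` to `A` consists of invertible elements. -/
def LogWellDefined {𝔄 : Type*} [NormedRing 𝔄] [NormedAlgebra ℝ 𝔄] (A : 𝔄) : Prop :=
  ∀ t ∈ Icc (0 : ℝ) 1, IsUnit ((1 - t) • (1 : 𝔄) + t • A)

/-- The (principal) logarithm
`log A = ∫₀¹ (A - 1) (s + (1 - s) A)⁻¹ ds` of an element of a Banach algebra;
meaningful when `LogWellDefined A` holds. -/
def algLog {𝔄 : Type*} [NormedRing 𝔄] [NormedAlgebra ℝ 𝔄] (A : 𝔄) : 𝔄 :=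
  ∫ s in (0 : ℝ)..1, (A - 1) * Ring.inverse (s • (1 : 𝔄) + (1 - s) • A)

/-- The image of an element of a real algebra in its complexification. The spectrum of an element
of a real algebra is understood to be the spectrum of this image. -/
def complexify {𝔄 : Type*} [Ring 𝔄] [Algebra ℝ 𝔄] (A : 𝔄) : ℂ ⊗[ℝ] 𝔄 :=
  (1 : ℂ) ⊗ₜ[ℝ] A

end

/-! On nonzero vectors `‖log (y : x)‖` is a length metric in disguise: its real part is additive
along `x, y, z` and its imaginary part is the angle, so
`‖log (z : x)‖ ≤ ‖log (z : y)‖ + ‖log (y : x)‖`. Since `φ` has no atoms, time can be cut into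
consecutive pieces of small variation, and Chen's identity factors `Lexp φ` into the ordered
exponentials of the pieces. Each of these is `1 + e` with `e` small and `∑ ‖e‖ ≤ (1 + ε) ∫ ‖φ‖`, and
moves a vector by at most `(1 + ε) ‖e‖` in this metric. Letting `ε → 0` bounds the conformal range.

A boundary point of the spectrum is an approximate eigenvalue, hence lies in the closure of the
conformal range. An interior point is moved radially away from the unit circle until it hits the
boundary of the spectrum; this increases the norm of its logarithm, so that it lies in
`exp D̄(0, r)` as well. If `r < π`, this set avoids the negative half line and its logarithms lie in
`D̄(0, r)`; as the spectrum of `log A` consists of logarithms of spectral values of `A`, this bounds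
the spectral radius. Real operators are extended to the complexified space. -/

section LowerSetPartition

variable {α : Type*} [LinearOrder α]

theorem exists_countable_cofinal_coinitial [TopologicalSpace α] [OrderClosedTopology α]
    [SecondCountableTopology α] (J : Set α) :
    ∃ D ⊆ J, D.Countable ∧ ∀ x ∈ J, (∃ a ∈ D, a ≤ x) ∧ ∃ b ∈ D, x ≤ b := by
  obtain ⟨D, hD, hdense, hbot, htop⟩ := exists_countable_dense_bot_top J
  refine ⟨(↑) '' D, Subtype.coe_image_subset _ _, hD.image _, fun x hx => ⟨?_, ?_⟩⟩
  · obtain ⟨a, ha, hax⟩ := hdense.exists_le' hbot ⟨x, hx⟩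
    exact ⟨a, mem_image_of_mem _ ha, hax⟩
  · obtain ⟨b, hb, hxb⟩ := hdense.exists_ge' htop ⟨x, hx⟩
    exact ⟨b, mem_image_of_mem _ hb, hxb⟩

variable [MeasurableSpace α] (μ : Measure α)

theorem measure_le_of_forall_measure_Icc_le [TopologicalSpace α] [OrderClosedTopology α]
    [SecondCountableTopology α] {J : Set α} {c : ENNReal}
    (h : ∀ s ∈ J, ∀ t ∈ J, μ (Icc s t) ≤ c) : μ J ≤ c := by
  obtain ⟨D, hDJ, hD, hcof⟩ := exists_countable_cofinal_coinitial J
  have : Countable D := hD.to_subtype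
  have hcover : J ⊆ ⋃ p : D × D, Icc (p.1 : α) p.2 := fun x hx => by
    obtain ⟨⟨a, ha, hax⟩, b, hb, hxb⟩ := hcof x hx
    exact mem_iUnion.2 ⟨(⟨a, ha⟩, ⟨b, hb⟩), hax, hxb⟩
  have hdir : Directed (· ⊆ ·) fun p : D × D => Icc (p.1 : α) p.2 := fun p q =>
    ⟨(min p.1 q.1, max p.2 q.2), Icc_subset_Icc (min_le_left _ _) (le_max_left _ _),
      Icc_subset_Icc (min_le_right _ _) (le_max_right _ _)⟩
  calc μ J ≤ μ (⋃ p : D × D, Icc (p.1 : α) p.2) := measure_mono hcover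
    _ = ⨆ p : D × D, μ (Icc (p.1 : α) p.2) := hdir.measure_iUnion
    _ ≤ c := iSup_le fun p => h _ (hDJ p.1.2) _ (hDJ p.2.2)

variable [IsFiniteMeasure μ]

theorem monotone_measureReal_Iic : Monotone fun t => μ.real (Iic t) :=
  fun _ _ hst => measureReal_mono (Iic_subset_Iic.2 hst)

variable [TopologicalSpace α] [OrderClosedTopology α] [OpensMeasurableSpace α]

theorem measure_Icc_eq_of_atomless (hμ : ∀ t, μ {t} = 0) {s t : α} (hst : s ≤ t) :
    μ (Icc s t) = ENNReal.ofReal (μ.real (Iic t) - μ.real (Iic s)) := by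
  have : NullSingletonClass μ := ⟨hμ⟩
  rw [← measure_congr Ioc_ae_eq_Icc, ← Iic_sdiff_Iic,
    ← measureReal_sdiff (Iic_subset_Iic.2 hst) measurableSet_Iic, ofReal_measureReal]

theorem exists_lowerSet_partition_of_atomless [SecondCountableTopology α]
    (hμ : ∀ t, μ {t} = 0) {δ : ℝ} (hδ : 0 < δ) :
    ∃ S : ℕ → Set α, S 0 = ∅ ∧ (∃ N, S N = univ) ∧ (∀ k, IsLowerSet (S k)) ∧ Monotone S ∧
      ∀ k, μ.real (S (k + 1) \ S k) ≤ δ := by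
  set F : α → ℝ := fun t => μ.real (Iic t)
  refine ⟨fun k => {t | F t < k * δ}, ?_, ?_, fun k s t hts => ?_, fun j k hjk => ?_, fun k => ?_⟩
  · exact eq_empty_of_forall_notMem fun t (ht : F t < (0 : ℕ) * δ) =>
      (measureReal_nonneg : 0 ≤ F t).not_gt (by simpa using ht)
  · obtain ⟨N, hN⟩ := exists_nat_gt (μ.real univ / δ)
    exact ⟨N, eq_univ_of_forall fun t =>
      (measureReal_mono (subset_univ _)).trans_lt ((div_lt_iff₀ hδ).1 hN)⟩
  · exact (monotone_measureReal_Iic μ hts).trans_lt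
  · have hjk' : (j : ℝ) * δ ≤ k * δ := by gcongr
    exact fun t (ht : F t < j * δ) => ht.trans_le hjk'
  · refine ENNReal.toReal_le_of_le_ofReal hδ.le (measure_le_of_forall_measure_Icc_le μ ?_)
    rintro s ⟨-, hs⟩ t ⟨ht, -⟩
    rcases le_or_gt s t with hst | hst
    · rw [measure_Icc_eq_of_atomless μ hμ hst]
      simp only [mem_ofPred_eq, not_lt, Nat.cast_add, Nat.cast_one] at hs ht
      exact ENNReal.ofReal_le_ofReal (by linarith)
    · simp [Icc_eq_empty_of_lt hst]

end LowerSetPartition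

theorem stronglyMeasurable_of_dist_le_mul_dist {α E : Type*} [MeasurableSpace α] [MetricSpace E]
    {F : α → ℝ} (hF : Measurable F) {g : α → E} {C : NNReal}
    (h : ∀ s t, dist (g s) (g t) ≤ C * dist (F s) (F t)) : StronglyMeasurable g := by
  let G : range F → E := g ∘ rangeSplitting F
  have hG : LipschitzWith C G := .of_dist_le_mul fun x y => by
    refine (h (rangeSplitting F x) (rangeSplitting F y)).trans_eq ?_
    rw [apply_rangeSplitting F, apply_rangeSplitting F, Subtype.dist_eq]
  have hgG : g = G ∘ rangeFactorization F := funext fun t => by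
    refine dist_le_zero.1 ((h _ _).trans_eq ?_)
    rw [apply_rangeSplitting F, rangeFactorization_coe, dist_self, mul_zero]
  rw [hgG]
  exact hG.continuous.stronglyMeasurable.comp_measurable hF.subtype_mk

section OrderedIntegral

open ContinuousLinearMap (mul)
open Finset.HasAntidiagonal (antidiagonal)

variable {α 𝔄 : Type*} [MeasurableSpace α] [NormedRing 𝔄] [NormedAlgebra ℝ 𝔄]
  (φ : VectorMeasure α 𝔄)

theorem norm_setIntegral_mul_flip_le [IsFiniteMeasure φ.variation] {f : α → 𝔄} {S : Set α} {C : ℝ}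
    (hC : 0 ≤ C) (hf : ∀ x ∈ S, ‖f x‖ ≤ C) :
    ‖∫ᵛ x in S, f x ∂[(mul ℝ 𝔄).flip; φ]‖ ≤ C * φ.variation.real S := by
  have hmul : ‖(mul ℝ 𝔄).flip‖ ≤ 1 := by
    rw [ContinuousLinearMap.opNorm_flip]
    exact ContinuousLinearMap.opNorm_mul_le ℝ 𝔄
  calc _ ≤ C * ‖(mul ℝ 𝔄).flip‖ * φ.variation.real S :=
        VectorMeasure.norm_setIntegral_le_of_norm_le_const hf
    _ ≤ C * 1 * φ.variation.real S := by gcongr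
    _ = C * φ.variation.real S := by rw [mul_one]

theorem integral_mul_const_mul_flip [CompleteSpace 𝔄] {f : α → 𝔄} (hf : φ.Integrable f) (c : 𝔄) :
    ∫ᵛ x, f x * c ∂[(mul ℝ 𝔄).flip; φ] = (∫ᵛ x, f x ∂[(mul ℝ 𝔄).flip; φ]) * c := by
  let R : 𝔄 →L[ℝ] 𝔄 := (mul ℝ 𝔄).flip c
  have hR : (mul ℝ 𝔄).flip ∘L R = ContinuousLinearMap.compL ℝ 𝔄 𝔄 𝔄 R ∘L (mul ℝ 𝔄).flip := by
    ext a b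
    exact (mul_assoc b a c).symm
  calc ∫ᵛ x, R (f x) ∂[(mul ℝ 𝔄).flip; φ]
      = ∫ᵛ x, f x ∂[(mul ℝ 𝔄).flip ∘L R; φ] := VectorMeasure.integral_continuousLinearMap_comp hf
    _ = R (∫ᵛ x, f x ∂[(mul ℝ 𝔄).flip; φ]) := by
      rw [hR, VectorMeasure.continuousLinearMap_apply_integral hf]

/-- `orderedIntegral φ n S = ∫_{t₁ ≤ ⋯ ≤ tₙ ∈ S} φ(tₙ) ⋯ φ(t₁)`. Only the last variable is
confined to `S`, so this is the ordered integral over `S` when `S` is a lower set. -/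
noncomputable def orderedIntegral [Preorder α] : ℕ → Set α → 𝔄
  | 0 => fun _ => 1
  | n + 1 => fun S => ∫ᵛ t in S, lexpTerm φ n t ∂[(mul ℝ 𝔄).flip; φ]

theorem orderedIntegral_succ [Preorder α] (n : ℕ) (S : Set α) :
    orderedIntegral φ (n + 1) S = ∫ᵛ t in S, lexpTerm φ n t ∂[(mul ℝ 𝔄).flip; φ] :=
  rfl

theorem lexpTerm_eq_orderedIntegral_Iic [Preorder α] (n : ℕ) (t : α) :
    lexpTerm φ n t = orderedIntegral φ n (Iic t) := by
  cases n <;> rfl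

theorem Lexp_eq_tsum_orderedIntegral [Preorder α]
    (h : Summable fun n => orderedIntegral φ n univ) :
    Lexp φ = ∑' n, orderedIntegral φ n univ := by
  rw [h.tsum_eq_zero_add]
  simp only [orderedIntegral, VectorMeasure.restrict_univ, Lexp]

section LowerSet

variable [LinearOrder α] [TopologicalSpace α] [OrderClosedTopology α] [BorelSpace α]
  [IsFiniteMeasure φ.variation]

theorem stronglyMeasurable_setIntegral_Iic {f : α → 𝔄} {C : NNReal} (hf : ∀ x, ‖f x‖ ≤ C)
    (hfi : φ.Integrable f) :
    StronglyMeasurable fun t => ∫ᵛ x in Iic t, f x ∂[(mul ℝ 𝔄).flip; φ] := by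
  set g : α → 𝔄 := fun t => ∫ᵛ x in Iic t, f x ∂[(mul ℝ 𝔄).flip; φ]
  set F : α → ℝ := fun t => φ.variation.real (Iic t)
  have hle : ∀ {s t}, s ≤ t → dist (g t) (g s) ≤ C * dist (F t) (F s) := fun {s t} hst => by
    have hsub : Iic s ⊆ Iic t := Iic_subset_Iic.2 hst
    calc dist (g t) (g s) = ‖∫ᵛ x in Iic t \ Iic s, f x ∂[(mul ℝ 𝔄).flip; φ]‖ := by
          rw [dist_eq_norm, VectorMeasure.setIntegral_sdiff measurableSet_Iic measurableSet_Iic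
            hfi.integrableOn hsub]
      _ ≤ C * φ.variation.real (Iic t \ Iic s) :=
          norm_setIntegral_mul_flip_le φ C.2 fun x _ => hf x
      _ ≤ C * dist (F t) (F s) := by
          rw [measureReal_sdiff hsub measurableSet_Iic, Real.dist_eq]
          gcongr
          exact le_abs_self _
  refine stronglyMeasurable_of_dist_le_mul_dist
    (monotone_measureReal_Iic φ.variation).measurable (C := C) fun s t => ?_
  rcases le_total s t with hst | hst
  · rw [dist_comm, dist_comm (φ.variation.real _)]
    exact hle hst
  · exact hle hst

theorem stronglyMeasurable_lexpTerm_and_exists_norm_le (n : ℕ) :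
    StronglyMeasurable (lexpTerm φ n) ∧ ∃ C : NNReal, ∀ t, ‖lexpTerm φ n t‖ ≤ C := by
  induction n with
  | zero => exact ⟨stronglyMeasurable_const, ‖(1 : 𝔄)‖₊, fun _ => le_rfl⟩
  | succ n ih =>
    obtain ⟨hm, C, hC⟩ := ih
    have hint : φ.Integrable (lexpTerm φ n) := .of_bound hm.aestronglyMeasurable C (.of_forall hC)
    refine ⟨stronglyMeasurable_setIntegral_Iic φ hC hint,
      C * (φ.variation univ).toNNReal, fun t => ?_⟩
    calc ‖lexpTerm φ (n + 1) t‖ ≤ C * φ.variation.real (Iic t) :=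
          norm_setIntegral_mul_flip_le φ C.2 fun x _ => hC x
      _ ≤ C * φ.variation.real univ := by
          gcongr
          · finiteness
          · exact subset_univ _

theorem integrable_lexpTerm (n : ℕ) : φ.Integrable (lexpTerm φ n) := by
  obtain ⟨hm, C, hC⟩ := stronglyMeasurable_lexpTerm_and_exists_norm_le φ n
  exact .of_bound hm.aestronglyMeasurable C (.of_forall hC)

theorem norm_orderedIntegral_succ_le [CompleteSpace 𝔄] (n : ℕ) {S : Set α} (hS : IsLowerSet S) :
    ‖orderedIntegral φ (n + 1) S‖ ≤ φ.variation.real S ^ (n + 1) := by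
  induction n generalizing S with
  | zero =>
    have hφS : orderedIntegral φ 1 S = φ S := by
      simp only [orderedIntegral, lexpTerm, VectorMeasure.integral_const]
      simp [VectorMeasure.restrict_apply, hS.ordConnected.measurableSet]
    rw [hφS, zero_add, pow_one]
    exact φ.norm_measure_le_variation (measure_ne_top _ _)
  | succ n ih =>
    rw [pow_succ]
    refine norm_setIntegral_mul_flip_le φ (by positivity) fun t ht => ?_
    rw [lexpTerm_eq_orderedIntegral_Iic]
    refine (ih (isLowerSet_Iic t)).trans ?_
    gcongr
    · finiteness
    · exact hS.Iic_subset ht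

theorem orderedIntegral_eq_sum_antidiagonal_mul [CompleteSpace 𝔄] (n : ℕ) {L S : Set α}
    (hL : IsLowerSet L) (hS : IsLowerSet S) (hLS : L ⊆ S) :
    orderedIntegral φ n S = ∑ p ∈ antidiagonal n,
      orderedIntegral (φ.restrict Lᶜ) p.1 S * orderedIntegral φ p.2 L := by
  induction n generalizing S with
  | zero => simp [orderedIntegral]
  | succ n ih =>
    have hLm : MeasurableSet L := hL.ordConnected.measurableSet
    have hSm : MeasurableSet S := hS.ordConnected.measurableSet
    have hrestrict : (φ.restrict Lᶜ).restrict S = φ.restrict (S \ L) := by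
      rw [VectorMeasure.restrict_restrict _ hSm hLm.compl, Set.sdiff_eq]
    have hterm : EqOn (lexpTerm φ n) (fun t => ∑ p ∈ antidiagonal n,
        lexpTerm (φ.restrict Lᶜ) p.1 t * orderedIntegral φ p.2 L) (S \ L) := fun t ht => by
      have hLt : L ⊆ Iic t := fun s hs => (le_total s t).resolve_right fun hts => ht.2 (hL hts hs)
      simp only [lexpTerm_eq_orderedIntegral_Iic, ih (isLowerSet_Iic t) hLt]
    have hint : ∀ m, (φ.restrict (S \ L)).Integrable (lexpTerm (φ.restrict Lᶜ) m) := fun m =>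
      hrestrict ▸ (integrable_lexpTerm (φ.restrict Lᶜ) m).restrict
    have hintmul : ∀ p ∈ antidiagonal n, (φ.restrict (S \ L)).Integrable fun t =>
        lexpTerm (φ.restrict Lᶜ) p.1 t * orderedIntegral φ p.2 L := fun p _ =>
      Integrable.mul_const (hint p.1) _
    have hdiff : ∫ᵛ t in S \ L, lexpTerm φ n t ∂[(mul ℝ 𝔄).flip; φ] =
        ∑ p ∈ antidiagonal n,
          orderedIntegral (φ.restrict Lᶜ) (p.1 + 1) S * orderedIntegral φ p.2 L := by
      rw [VectorMeasure.setIntegral_congr_fun hterm, VectorMeasure.integral_finsetSum _ hintmul]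
      refine Finset.sum_congr rfl fun p _ => ?_
      rw [integral_mul_const_mul_flip _ (hint p.1), orderedIntegral_succ, hrestrict]
    rw [Finset.Nat.sum_antidiagonal_succ, ← hdiff]
    simp only [orderedIntegral, one_mul]
    rw [← VectorMeasure.setIntegral_inter_add_sdiff hSm hLm (integrable_lexpTerm φ n).integrableOn,
      inter_eq_right.2 hLS]

end LowerSet

end OrderedIntegral

section OrderedExponential

variable {α 𝔄 : Type*} [MeasurableSpace α] [NormedRing 𝔄] [NormedAlgebra ℝ 𝔄] [LinearOrder α]

/-- The time-ordered exponential `∑ₙ ∫_{t₁ ≤ ⋯ ≤ tₙ ∈ S} φ(tₙ) ⋯ φ(t₁)` of `φ` over a lower set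
`S`. -/
noncomputable def orderedExp (φ : VectorMeasure α 𝔄) (S : Set α) : 𝔄 :=
  ∑' n, orderedIntegral φ n S

theorem orderedIntegral_empty (φ : VectorMeasure α 𝔄) (n : ℕ) :
    orderedIntegral φ n ∅ = if n = 0 then 1 else 0 := by
  cases n with
  | zero => rfl
  | succ n => exact VectorMeasure.setIntegral_empty

theorem orderedExp_empty (φ : VectorMeasure α 𝔄) : orderedExp φ ∅ = 1 := by
  simp only [orderedExp, orderedIntegral_empty, tsum_ite_eq]

variable [TopologicalSpace α] [OrderClosedTopology α] [BorelSpace α] [CompleteSpace 𝔄]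
  (φ : VectorMeasure α 𝔄) [IsFiniteMeasure φ.variation] {L S : Set α}

theorem summable_norm_orderedIntegral_of_lt_one (hS : IsLowerSet S) (h : φ.variation.real S < 1) :
    Summable fun n => ‖orderedIntegral φ n S‖ :=
  (summable_nat_add_iff 1).1 <| .of_nonneg_of_le (fun _ => norm_nonneg _)
    (fun n => norm_orderedIntegral_succ_le φ n hS)
    ((summable_nat_add_iff 1).2 (summable_geometric_of_lt_one measureReal_nonneg h))

theorem norm_orderedExp_sub_one_le (hS : IsLowerSet S) {ε : ℝ} (hε : 0 < ε)
    (h : φ.variation.real S ≤ ε / (1 + ε)) :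
    ‖orderedExp φ S - 1‖ ≤ (1 + ε) * φ.variation.real S := by
  set v := φ.variation.real S
  have hv : 0 ≤ v := measureReal_nonneg
  have hv1 : v * (1 + ε) ≤ ε := (le_div_iff₀ (by positivity)).1 h
  have hlt : v < 1 := by nlinarith
  have hsum := (summable_norm_orderedIntegral_of_lt_one φ hS hlt).of_norm
  have htail : orderedExp φ S - 1 = ∑' n, orderedIntegral φ (n + 1) S := by
    rw [orderedExp, hsum.tsum_eq_zero_add]
    exact add_sub_cancel_left _ _
  calc ‖orderedExp φ S - 1‖ ≤ v * (1 - v)⁻¹ := by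
        rw [htail]
        refine tsum_of_norm_bounded ((hasSum_geometric_of_lt_one hv hlt).mul_left v) fun n => ?_
        rw [← pow_succ']
        exact norm_orderedIntegral_succ_le φ n hS
    _ ≤ v * (1 + ε) := by
        gcongr
        rw [inv_le_iff_one_le_mul₀ (by linarith)]
        linarith
    _ = (1 + ε) * v := mul_comm _ _

theorem summable_norm_orderedIntegral_of_subset (hL : IsLowerSet L) (hS : IsLowerSet S)
    (hLS : L ⊆ S) (hsumL : Summable fun n => ‖orderedIntegral φ n L‖)
    (hsumS : Summable fun n => ‖orderedIntegral (φ.restrict Lᶜ) n S‖) :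
    Summable fun n => ‖orderedIntegral φ n S‖ := by
  refine (summable_norm_sum_mul_antidiagonal_of_summable_norm hsumS hsumL).congr fun n => ?_
  rw [orderedIntegral_eq_sum_antidiagonal_mul φ n hL hS hLS]

theorem orderedExp_eq_mul (hL : IsLowerSet L) (hS : IsLowerSet S)
    (hLS : L ⊆ S) (hsumL : Summable fun n => ‖orderedIntegral φ n L‖)
    (hsumS : Summable fun n => ‖orderedIntegral (φ.restrict Lᶜ) n S‖) :
    orderedExp φ S = orderedExp (φ.restrict Lᶜ) S * orderedExp φ L := by
  simp only [orderedExp, fun n => orderedIntegral_eq_sum_antidiagonal_mul φ n hL hS hLS]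
  exact (tsum_mul_tsum_eq_tsum_sum_antidiagonal_of_summable_norm hsumS hsumL).symm

theorem exists_list_prod_eq_orderedExp {ε : ℝ} (hε : 0 < ε) {S : ℕ → Set α} (h0 : S 0 = ∅)
    (hlower : ∀ k, IsLowerSet (S k)) (hmono : Monotone S)
    (hsmall : ∀ k, φ.variation.real (S (k + 1) \ S k) ≤ ε / (1 + ε)) (k : ℕ) :
    (Summable fun n => ‖orderedIntegral φ n (S k)‖) ∧
      ∃ l : List 𝔄, (∀ e ∈ l, ‖e‖ ≤ ε) ∧
        (l.map norm).sum ≤ (1 + ε) * φ.variation.real (S k) ∧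
        (l.map (1 + ·)).prod = orderedExp φ (S k) := by
  induction k with
  | zero =>
    rw [h0, orderedExp_empty]
    exact ⟨summable_norm_orderedIntegral_of_lt_one φ isLowerSet_empty (by simp), [], by simp⟩
  | succ k ih =>
    obtain ⟨hsum, l, hl, hlsum, hprod⟩ := ih
    have hsub : S k ⊆ S (k + 1) := hmono k.le_succ
    have hLm : MeasurableSet (S k) := (hlower k).ordConnected.measurableSet
    set ψ := φ.restrict (S k)ᶜ
    have hψ : ψ.variation.real (S (k + 1)) = φ.variation.real (S (k + 1) \ S k) := by
      rw [VectorMeasure.variation_restrict hLm.compl,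
        measureReal_restrict_apply (hlower _).ordConnected.measurableSet, Set.sdiff_eq]
    have hsmallψ : ψ.variation.real (S (k + 1)) ≤ ε / (1 + ε) := hψ ▸ hsmall k
    have hsumψ := summable_norm_orderedIntegral_of_lt_one ψ (hlower (k + 1))
      (hsmallψ.trans_lt ((div_lt_one (by positivity)).2 (by linarith)))
    have he : ‖orderedExp ψ (S (k + 1)) - 1‖ ≤ (1 + ε) * φ.variation.real (S (k + 1) \ S k) :=
      hψ ▸ norm_orderedExp_sub_one_le ψ (hlower (k + 1)) hε hsmallψ
    refine ⟨summable_norm_orderedIntegral_of_subset φ (hlower k) (hlower _) hsub hsum hsumψ,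
      (orderedExp ψ (S (k + 1)) - 1) :: l, List.forall_mem_cons.2 ⟨?_, hl⟩, ?_, ?_⟩
    · have := (le_div_iff₀ (by positivity)).1 (hsmall k)
      linarith
    · rw [measureReal_sdiff hsub hLm] at he
      rw [List.map_cons, List.sum_cons]
      linarith
    · rw [List.map_cons, List.prod_cons, hprod, add_sub_cancel,
        orderedExp_eq_mul φ (hlower k) (hlower _) hsub hsum hsumψ]

end OrderedExponential

section Lexp

variable {α 𝔄 : Type*} [MeasurableSpace α] [NormedRing 𝔄] [NormedAlgebra ℝ 𝔄]
  [LinearOrder α] [TopologicalSpace α] [OrderClosedTopology α] [SecondCountableTopology α]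
  [BorelSpace α] [CompleteSpace 𝔄] {φ : VectorMeasure α 𝔄}

theorem exists_list_prod_eq_Lexp (hφ : totalVariation φ < ⊤) (hatom : ∀ t, φ {t} = 0) {ε : ℝ}
    (hε : 0 < ε) :
    ∃ l : List 𝔄, (∀ e ∈ l, ‖e‖ ≤ ε) ∧
      (l.map norm).sum ≤ (1 + ε) * (totalVariation φ).toReal ∧
      (l.map (1 + ·)).prod = Lexp φ := by
  have : IsFiniteMeasure φ.variation := ⟨hφ⟩
  have hatom' : ∀ t, φ.variation {t} = 0 := fun t => by
    refine (φ.variation_apply_eq_zero (measurableSet_singleton t)).2 fun s hs _ => ?_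
    rcases subset_singleton_iff_eq.1 hs with rfl | rfl
    exacts [φ.empty, hatom t]
  obtain ⟨S, h0, ⟨N, hN⟩, hlower, hmono, hsmall⟩ :=
    exists_lowerSet_partition_of_atomless φ.variation hatom' (show 0 < ε / (1 + ε) by positivity)
  have h := exists_list_prod_eq_orderedExp φ hε h0 hlower hmono hsmall N
  rw [hN] at h
  rw [Lexp_eq_tsum_orderedIntegral φ h.1.of_norm]
  exact h.2

theorem isUnit_Lexp (hφ : totalVariation φ < ⊤) (hatom : ∀ t, φ {t} = 0) : IsUnit (Lexp φ) := by
  obtain ⟨l, hl, -, hprod⟩ := exists_list_prod_eq_Lexp hφ hatom (ε := 1 / 2) (by norm_num)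
  rw [← hprod]
  refine List.prod_isUnit (List.forall_mem_map.2 fun e he => ?_)
  rw [← sub_neg_eq_add]
  exact isUnit_one_sub_of_norm_lt_one
    ((norm_neg e).trans_lt ((hl e he).trans_lt (by norm_num)))

end Lexp

section ConformalQuot

variable {𝕜 H : Type*} [RCLike 𝕜] [NormedAddCommGroup H] [InnerProductSpace 𝕜 H] {x y z : H}

local notation "⟪" x ", " y "⟫" => inner 𝕜 x y

theorem conformalQuot_im (y x : H) :
    (conformalQuot 𝕜 y x).im = ‖y - ((RCLike.re ⟪y, x⟫ / ‖x‖ ^ 2 : ℝ) : 𝕜) • x‖ / ‖x‖ := by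
  rw [conformalQuot, smul_comm, ← smul_sub, norm_smul, RCLike.norm_ofReal, abs_inv, abs_norm,
    inv_mul_eq_div]

theorem conformalQuot_im_nonneg (y x : H) : 0 ≤ (conformalQuot 𝕜 y x).im :=
  norm_nonneg _

theorem norm_conformalQuot (y x : H) : ‖conformalQuot 𝕜 y x‖ = ‖y‖ / ‖x‖ := by
  rcases eq_or_ne x 0 with rfl | hx
  · simp [Complex.ext_iff, conformalQuot]
  have hx' : ‖x‖ ≠ 0 := norm_ne_zero_iff.2 hx
  have hre : (conformalQuot 𝕜 y x).re = RCLike.re ⟪y, x⟫ / ‖x‖ ^ 2 := rfl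
  rw [← sq_eq_sq₀ (norm_nonneg _) (by positivity), Complex.sq_norm, Complex.normSq_apply,
    ← sq, ← sq, hre, conformalQuot_im, div_pow _ ‖x‖, norm_sub_sq (𝕜 := 𝕜), inner_smul_right,
    RCLike.re_ofReal_mul, norm_smul, mul_pow, RCLike.norm_ofReal, sq_abs]
  field_simp
  ring

theorem conformalQuot_self (hx : x ≠ 0) : conformalQuot 𝕜 x x = 1 := by
  have hre : RCLike.re ⟪x, x⟫ / ‖x‖ ^ 2 = 1 := by
    rw [inner_self_eq_norm_sq, div_self (pow_ne_zero 2 (norm_ne_zero_iff.2 hx))]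
  refine Complex.ext hre ?_
  rw [conformalQuot_im, hre]
  simp

theorem conformalQuot_ne_zero (hy : y ≠ 0) (hx : x ≠ 0) : conformalQuot 𝕜 y x ≠ 0 := by
  rw [← norm_ne_zero_iff, norm_conformalQuot]
  exact div_ne_zero (norm_ne_zero_iff.2 hy) (norm_ne_zero_iff.2 hx)

theorem norm_conformalQuot_sub_le (y z x : H) :
    ‖conformalQuot 𝕜 y x - conformalQuot 𝕜 z x‖ ≤ ‖y - z‖ / ‖x‖ := by
  rw [← norm_conformalQuot (𝕜 := 𝕜), ← sq_le_sq₀ (norm_nonneg _) (norm_nonneg _), Complex.sq_norm,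
    Complex.sq_norm, Complex.normSq_apply, Complex.normSq_apply, ← sq, ← sq, ← sq, ← sq]
  have hre : (conformalQuot 𝕜 y x - conformalQuot 𝕜 z x).re = (conformalQuot 𝕜 (y - z) x).re := by
    simp [conformalQuot, inner_sub_left, sub_div]
  have him : |(conformalQuot 𝕜 y x - conformalQuot 𝕜 z x).im| ≤ (conformalQuot 𝕜 (y - z) x).im := by
    rw [Complex.sub_im, conformalQuot_im, conformalQuot_im, conformalQuot_im, ← sub_div, abs_div,
      abs_norm]
    gcongr
    refine (abs_norm_sub_norm_le _ _).trans_eq (congrArg norm ?_)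
    rw [inner_sub_left, map_sub, sub_div, RCLike.ofReal_sub, sub_smul]
    abel
  rw [hre]
  exact add_le_add_right (sq_le_sq' (neg_le_of_abs_le him) (le_of_abs_le him)) _

theorem arg_conformalQuot (hy : y ≠ 0) (hx : x ≠ 0) :
    (conformalQuot 𝕜 y x).arg = Real.arccos (RCLike.re ⟪y, x⟫ / (‖y‖ * ‖x‖)) := by
  have hx' : ‖x‖ ≠ 0 := norm_ne_zero_iff.2 hx
  rw [Complex.arg_of_im_nonneg_of_ne_zero (conformalQuot_im_nonneg y x)
    (conformalQuot_ne_zero hy hx), norm_conformalQuot]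
  congr 1
  simp only [conformalQuot]
  field_simp

theorem arg_conformalQuot_le_add (hx : x ≠ 0) (hy : y ≠ 0) (hz : z ≠ 0) :
    (conformalQuot 𝕜 z x).arg ≤ (conformalQuot 𝕜 z y).arg + (conformalQuot 𝕜 y x).arg := by
  let _ := InnerProductSpace.rclikeToReal 𝕜 H
  simp only [arg_conformalQuot, hx, hy, hz, ne_eq, not_false_eq_true,
    ← real_inner_eq_re_inner 𝕜]
  exact InnerProductGeometry.angle_le_angle_add_angle z y x

theorem norm_log_conformalQuot_le_add (hx : x ≠ 0) (hy : y ≠ 0) (hz : z ≠ 0) :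
    ‖Complex.log (conformalQuot 𝕜 z x)‖ ≤
      ‖Complex.log (conformalQuot 𝕜 z y)‖ + ‖Complex.log (conformalQuot 𝕜 y x)‖ := by
  refine le_trans ?_ (norm_add_le _ _)
  have hre : (Complex.log (conformalQuot 𝕜 z x)).re =
      (Complex.log (conformalQuot 𝕜 z y)).re + (Complex.log (conformalQuot 𝕜 y x)).re := by
    have hx' := norm_ne_zero_iff.2 hx
    have hy' := norm_ne_zero_iff.2 hy
    have hz' := norm_ne_zero_iff.2 hz
    simp only [Complex.log_re, norm_conformalQuot, Real.log_div, hx', hy', hz', ne_eq,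
      not_false_eq_true]
    ring
  have him : 0 ≤ (Complex.log (conformalQuot 𝕜 z x)).im := by
    rw [Complex.log_im, Complex.arg_nonneg_iff]
    exact conformalQuot_im_nonneg (𝕜 := 𝕜) z x
  rw [← sq_le_sq₀ (norm_nonneg _) (norm_nonneg _), Complex.sq_norm, Complex.sq_norm,
    Complex.normSq_apply, Complex.normSq_apply, ← sq, ← sq, ← sq, ← sq, Complex.add_re,
    Complex.add_im, hre]
  gcongr
  simpa only [Complex.log_im] using arg_conformalQuot_le_add (𝕜 := 𝕜) hx hy hz

end ConformalQuot

section ConformalRangeLexp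

theorem norm_log_one_add_le_of_le {w : ℂ} {a ε : ℝ} (hw : ‖w‖ ≤ a) (ha : a ≤ ε) (hε : ε ≤ 1 / 2) :
    ‖Complex.log (1 + w)‖ ≤ (1 + ε) * a := by
  have h0 := norm_nonneg w
  have hinv : (1 - ‖w‖)⁻¹ ≤ 2 := by
    rw [inv_le_comm₀ (by linarith) (by norm_num)]
    linarith
  calc ‖Complex.log (1 + w)‖ ≤ ‖w‖ ^ 2 * (1 - ‖w‖)⁻¹ / 2 + ‖w‖ :=
        Complex.norm_log_one_add_le (by linarith)
    _ ≤ ‖w‖ ^ 2 * 2 / 2 + ‖w‖ := by gcongr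
    _ ≤ (1 + ε) * a := by nlinarith

variable {𝕜 H 𝔄 : Type*} [RCLike 𝕜] [NormedAddCommGroup H] [InnerProductSpace 𝕜 H] {x : H}
  [NormedRing 𝔄]

theorem norm_log_conformalQuot_add_le {y v : H} {a ε : ℝ} (hy : y ≠ 0) (hv : ‖v‖ ≤ a * ‖y‖)
    (ha : a ≤ ε) (hε : ε ≤ 1 / 2) :
    ‖Complex.log (conformalQuot 𝕜 (y + v) y)‖ ≤ (1 + ε) * a := by
  have h : ‖conformalQuot 𝕜 (y + v) y - 1‖ ≤ a := by
    rw [← conformalQuot_self (𝕜 := 𝕜) hy]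
    refine (norm_conformalQuot_sub_le _ _ _).trans ?_
    rwa [add_sub_cancel_left, div_le_iff₀ (norm_pos_iff.2 hy)]
  simpa only [add_sub_cancel] using norm_log_one_add_le_of_le h ha hε

theorem norm_log_conformalQuot_list_prod_le (ρ : 𝔄 →+* (H →L[𝕜] H))
    (hρ : ∀ a v, ‖ρ a v‖ ≤ ‖a‖ * ‖v‖) {ε : ℝ} (hε : ε ≤ 1 / 2) {l : List 𝔄}
    (hl : ∀ e ∈ l, ‖e‖ ≤ ε) (hx : x ≠ 0) :
    ρ (l.map (1 + ·)).prod x ≠ 0 ∧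
      ‖Complex.log (conformalQuot 𝕜 (ρ (l.map (1 + ·)).prod x) x)‖ ≤
        (1 + ε) * (l.map norm).sum := by
  induction l with
  | nil => simp [conformalQuot_self hx, hx]
  | cons e l ih =>
    obtain ⟨he, hl⟩ := List.forall_mem_cons.1 hl
    obtain ⟨hy, hle⟩ := ih hl
    set y := ρ (l.map (1 + ·)).prod x with hy_def
    have hz : ρ ((e :: l).map (1 + ·)).prod x = y + ρ e y := by simp [hy_def]
    have hz0 : y + ρ e y ≠ 0 := fun h0 => by
      have hnorm : ‖y‖ = ‖ρ e y‖ := by rw [← norm_neg, neg_eq_of_add_eq_zero_right h0]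
      nlinarith [hρ e y, norm_pos_iff.2 hy]
    rw [hz, List.map_cons, List.sum_cons, mul_add]
    exact ⟨hz0, (norm_log_conformalQuot_le_add hx hy hz0).trans
      (add_le_add (norm_log_conformalQuot_add_le hy (hρ e y) he hε) hle)⟩

theorem conj_mem_exp_image_closedBall {r : ℝ} {z : ℂ}
    (hz : z ∈ Complex.exp '' Metric.closedBall 0 r) :
    starRingEnd ℂ z ∈ Complex.exp '' Metric.closedBall 0 r := by
  obtain ⟨w, hw, rfl⟩ := hz
  refine ⟨starRingEnd ℂ w, ?_, Complex.exp_conj w⟩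
  simpa only [mem_closedBall_zero_iff, Complex.norm_conj] using hw

theorem conformalRange_subset_of_norm_log_le {A : H →L[𝕜] H} {r : ℝ}
    (h : ∀ x, x ≠ 0 → A x ≠ 0 ∧ ‖Complex.log (conformalQuot 𝕜 (A x) x)‖ ≤ r) :
    conformalRange A ⊆ Complex.exp '' Metric.closedBall 0 r := by
  have hmem (x : H) (hx : x ≠ 0) :
      conformalQuot 𝕜 (A x) x ∈ Complex.exp '' Metric.closedBall 0 r :=
    ⟨_, mem_closedBall_zero_iff.2 (h x hx).2,
      Complex.exp_log (conformalQuot_ne_zero (h x hx).1 hx)⟩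
  rintro z ⟨x, hx, rfl | rfl⟩
  exacts [hmem x hx, conj_mem_exp_image_closedBall (hmem x hx)]

theorem conformalRange_map_Lexp_subset {α : Type*} [LinearOrder α] [TopologicalSpace α]
    [OrderClosedTopology α] [SecondCountableTopology α] [MeasurableSpace α] [BorelSpace α]
    [NormedAlgebra ℝ 𝔄] [CompleteSpace 𝔄] {φ : VectorMeasure α 𝔄} (hφ : totalVariation φ < ⊤)
    (hatom : ∀ t, φ {t} = 0) (ρ : 𝔄 →+* (H →L[𝕜] H)) (hρ : ∀ a v, ‖ρ a v‖ ≤ ‖a‖ * ‖v‖) :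
    conformalRange (ρ (Lexp φ)) ⊆ Complex.exp '' Metric.closedBall 0 (totalVariation φ).toReal := by
  refine conformalRange_subset_of_norm_log_le fun x hx => ?_
  set r := (totalVariation φ).toReal
  have hbound (ε : ℝ) (h0 : 0 < ε) (hε : ε ≤ 1 / 2) : ρ (Lexp φ) x ≠ 0 ∧
      ‖Complex.log (conformalQuot 𝕜 (ρ (Lexp φ) x) x)‖ ≤ (1 + ε) * ((1 + ε) * r) := by
    obtain ⟨l, hl, hsum, hprod⟩ := exists_list_prod_eq_Lexp hφ hatom h0
    obtain ⟨hne, hle⟩ := norm_log_conformalQuot_list_prod_le ρ hρ hε hl hx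
    rw [hprod] at hne hle
    exact ⟨hne, hle.trans (by gcongr)⟩
  refine ⟨(hbound (1 / 2) (by norm_num) le_rfl).1, ?_⟩
  have hlim : Filter.Tendsto (fun ε : ℝ => (1 + ε) * ((1 + ε) * r)) (nhdsWithin 0 (Ioi 0))
      (nhds r) :=
    tendsto_nhdsWithin_of_tendsto_nhds <|
      (by fun_prop : Continuous fun ε : ℝ => (1 + ε) * ((1 + ε) * r)).tendsto' _ _ (by simp)
  refine ge_of_tendsto hlim ?_
  filter_upwards [Ioc_mem_nhdsGT (show (0 : ℝ) < 1 / 2 by norm_num)] with ε hε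
  exact (hbound ε hε.1 hε.2).2

end ConformalRangeLexp

section SpectrumConformalRange

theorem isUnit_of_mem_closure_isUnit_of_le_norm {𝕜 E : Type*} [NontriviallyNormedField 𝕜]
    [NormedAddCommGroup E] [NormedSpace 𝕜 E] [CompleteSpace E] {T : E →L[𝕜] E} {c : ℝ}
    (hc : 0 < c) (hT : ∀ x, c * ‖x‖ ≤ ‖T x‖) (hcl : T ∈ closure {S | IsUnit S}) : IsUnit T := by
  nontriviality E →L[𝕜] E
  obtain ⟨_, ⟨u, rfl⟩, hu⟩ := Metric.mem_closure_iff.1 hcl (c / 2) (half_pos hc)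
  rw [dist_eq_norm] at hu
  have hinv : ‖(↑u⁻¹ : E →L[𝕜] E)‖ ≤ (c / 2)⁻¹ := by
    refine ContinuousLinearMap.opNorm_le_bound _ (by positivity) fun y => ?_
    set x := (↑u⁻¹ : E →L[𝕜] E) y with hx
    have huy : (u : E →L[𝕜] E) x = y := by
      rw [hx, ← mul_apply_eq_comp, Units.mul_inv, one_apply_eq_self]
    rw [inv_mul_eq_div, le_div_iff₀ (half_pos hc)]
    calc ‖x‖ * (c / 2) = c * ‖x‖ - c / 2 * ‖x‖ := by ring
      _ ≤ ‖T x‖ - ‖(T - u) x‖ := by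
        gcongr
        exacts [hT x, (T - u).le_of_opNorm_le hu.le x]
      _ ≤ ‖T x - (T - u) x‖ := norm_sub_norm_le _ _
      _ = ‖y‖ := by rw [sub_apply, sub_sub_cancel, huy]
  refine (u.ofNearby T (hu.trans_le ?_)).isUnit
  rwa [le_inv_comm₀ (half_pos hc) (Units.norm_pos _)]

theorem inter_frontier_nonempty_of_isPreconnected {X : Type*} [TopologicalSpace X] {S T : Set X}
    (hS : IsPreconnected S) (hT : (S ∩ T).Nonempty) (hT' : (S ∩ Tᶜ).Nonempty) :
    (S ∩ frontier T).Nonempty := by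
  by_contra! hempty
  have hsub : S ⊆ interior T ∪ interior Tᶜ := by
    rw [← compl_frontier_eq_union_interior]
    exact subset_compl_iff_disjoint_right.2 (disjoint_iff_inter_eq_empty.2 hempty)
  obtain ⟨x, hxS, hx⟩ := hT
  obtain ⟨y, hyS, hy⟩ := hT'
  have hxi : x ∈ interior T :=
    (hsub hxS).resolve_right fun h => interior_subset h hx
  have hyi : y ∈ interior Tᶜ :=
    (hsub hyS).resolve_left fun h => hy (interior_subset h)
  obtain ⟨z, -, hz, hz'⟩ := hS _ _ isOpen_interior isOpen_interior hsub ⟨x, hxS, hxi⟩ ⟨y, hyS, hyi⟩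
  exact interior_subset hz' (interior_subset hz)

theorem mem_exp_image_closedBall_of_mul_mem {r t : ℝ} {z : ℂ} (ht : 0 < t)
    (hlog : |Real.log ‖z‖| ≤ |Real.log ‖t * z‖|)
    (hz : t * z ∈ Complex.exp '' Metric.closedBall 0 r) :
    z ∈ Complex.exp '' Metric.closedBall 0 r := by
  obtain ⟨w, hw, hwz⟩ := hz
  rw [mem_closedBall_zero_iff] at hw
  have hexp : Complex.exp (w - Real.log t) = z := by
    have ht' : (t : ℂ) ≠ 0 := Complex.ofReal_ne_zero.2 ht.ne'
    rw [Complex.exp_sub, hwz, ← Complex.ofReal_exp, Real.exp_log ht, mul_div_cancel_left₀ _ ht']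
  refine ⟨w - Real.log t, mem_closedBall_zero_iff.2 (le_trans ?_ hw), hexp⟩
  rw [← hwz, ← hexp, Complex.norm_exp, Complex.norm_exp, Real.log_exp, Real.log_exp] at hlog
  rw [← sq_le_sq₀ (norm_nonneg _) (norm_nonneg _), Complex.sq_norm, Complex.sq_norm,
    Complex.normSq_apply, Complex.normSq_apply, ← sq, ← sq, ← sq, ← sq]
  have him : (w - Real.log t).im = w.im := by simp
  rw [him]
  exact add_le_add_left (sq_le_sq.2 hlog) _

theorem exists_mul_mem_frontier {T : Set ℂ} {s : Set ℝ} {z : ℂ} {t : ℝ} (hs : IsPreconnected s)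
    (h1 : 1 ∈ s) (hz : z ∈ T) (ht : t ∈ s) (htz : (t * z : ℂ) ∉ T) :
    ∃ t ∈ s, (t * z : ℂ) ∈ frontier T := by
  obtain ⟨_, ⟨t, ht, rfl⟩, hmem⟩ := inter_frontier_nonempty_of_isPreconnected
    (hs.image (fun t : ℝ => (t * z : ℂ)) (by fun_prop)) ⟨z, ⟨1, h1, by simp⟩, hz⟩
    ⟨t * z, ⟨t, ht, rfl⟩, htz⟩
  exact ⟨t, ht, hmem⟩

/- A point `z` of `T` is moved radially, away from the unit circle, until it leaves `T`: at infinity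
if `1 ≤ ‖z‖`, at `0` if `‖z‖ ≤ 1`. -/
theorem subset_exp_image_closedBall_of_frontier_subset {T : Set ℂ} {r : ℝ} (hT : IsCompact T)
    (h0 : 0 ∉ T) (h : frontier T ⊆ Complex.exp '' Metric.closedBall 0 r) :
    T ⊆ Complex.exp '' Metric.closedBall 0 r := by
  intro z hz
  have hpos : 0 < ‖z‖ := norm_pos_iff.2 fun h => h0 (h ▸ hz)
  have hnorm {t : ℝ} (ht : 0 ≤ t) : ‖(t * z : ℂ)‖ = t * ‖z‖ := by
    rw [norm_mul, Complex.norm_of_nonneg ht]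
  rcases le_total 1 ‖z‖ with h1 | h1
  · obtain ⟨b, hb, hbT⟩ := hT.isBounded.exists_pos_norm_le
    have hout : ((b + 1 : ℝ) * z : ℂ) ∉ T := fun hmem => by
      have := hbT _ hmem
      rw [hnorm (by positivity)] at this
      nlinarith
    obtain ⟨t, ht, hmem⟩ := exists_mul_mem_frontier isPreconnected_Ici self_mem_Ici hz
      (mem_Ici.2 (by linarith : 1 ≤ b + 1)) hout
    have ht0 : 0 < t := zero_lt_one.trans_le ht
    have hle : ‖z‖ ≤ t * ‖z‖ := le_mul_of_one_le_left (norm_nonneg z) ht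
    refine mem_exp_image_closedBall_of_mul_mem ht0 ?_ (h hmem)
    rw [hnorm ht0.le, abs_of_nonneg (Real.log_nonneg h1),
      abs_of_nonneg (Real.log_nonneg (h1.trans hle))]
    exact Real.log_le_log hpos hle
  · obtain ⟨t, ht, hmem⟩ := exists_mul_mem_frontier isPreconnected_Icc
      (right_mem_Icc.2 zero_le_one) hz (left_mem_Icc.2 zero_le_one) (by simpa using h0)
    have ht0 : 0 < t := ht.1.lt_of_ne fun h =>
      h0 (by simpa [← h] using hT.isClosed.frontier_subset hmem)
    have hle : t * ‖z‖ ≤ ‖z‖ := mul_le_of_le_one_left (norm_nonneg z) ht.2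
    refine mem_exp_image_closedBall_of_mul_mem ht0 ?_ (h hmem)
    rw [hnorm ht0.le, abs_of_nonpos (Real.log_nonpos hpos.le h1),
      abs_of_nonpos (Real.log_nonpos (by positivity) (hle.trans h1)), neg_le_neg_iff]
    exact Real.log_le_log (by positivity) hle

theorem conj_mem_conformalRange {𝕜 H : Type*} [RCLike 𝕜] [NormedAddCommGroup H]
    [InnerProductSpace 𝕜 H] {A : H →L[𝕜] H} {z : ℂ} (hz : z ∈ conformalRange A) :
    starRingEnd ℂ z ∈ conformalRange A := by
  obtain ⟨x, hx, rfl | rfl⟩ := hz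
  · exact ⟨x, hx, .inr rfl⟩
  · exact ⟨x, hx, .inl (Complex.conj_conj _)⟩

variable {K : Type*} [NormedAddCommGroup K] [InnerProductSpace ℂ K]

theorem conformalQuot_smul_self {x : K} (hx : x ≠ 0) (z : ℂ) :
    conformalQuot ℂ (z • x) x = ⟨z.re, |z.im|⟩ := by
  have hx' : ‖x‖ ≠ 0 := norm_ne_zero_iff.2 hx
  have hre : (conformalQuot ℂ (z • x) x).re = z.re := by
    simp only [conformalQuot, inner_smul_left, inner_self_eq_norm_sq_to_K]
    rw [← RCLike.ofReal_pow, mul_comm, RCLike.re_ofReal_mul,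
      mul_div_cancel_left₀ _ (pow_ne_zero 2 hx')]
    exact Complex.conj_re z
  refine Complex.ext hre ((sq_eq_sq₀ (conformalQuot_im_nonneg _ _) (abs_nonneg _)).1 ?_)
  have hnorm := congrArg (· ^ 2) (norm_conformalQuot (𝕜 := ℂ) (z • x) x)
  rw [norm_smul, mul_div_cancel_right₀ _ hx'] at hnorm
  simp only [Complex.sq_norm, Complex.normSq_apply, hre] at hnorm
  rw [sq_abs]
  linarith

theorem exists_mem_conformalRange_norm_sub_le (A : K →L[ℂ] K) {x : K} (hx : x ≠ 0) (z : ℂ) :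
    ∃ w ∈ conformalRange A, ‖z - w‖ * ‖x‖ ≤ ‖z • x - A x‖ := by
  have hq := norm_conformalQuot_sub_le (𝕜 := ℂ) (z • x) (A x) x
  rw [conformalQuot_smul_self hx, le_div_iff₀ (norm_pos_iff.2 hx)] at hq
  have hmem : conformalQuot ℂ (A x) x ∈ conformalRange A := ⟨x, hx, .inl rfl⟩
  rcases le_total 0 z.im with him | him
  · refine ⟨_, hmem, ?_⟩
    rwa [abs_of_nonneg him] at hq
  · refine ⟨_, conj_mem_conformalRange hmem, ?_⟩
    rw [abs_of_nonpos him] at hq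
    rwa [← Complex.norm_conj, map_sub, Complex.conj_conj]

variable [CompleteSpace K] {A : K →L[ℂ] K}

theorem frontier_spectrum_subset_closure_conformalRange (A : K →L[ℂ] K) :
    frontier (spectrum ℂ A) ⊆ closure (conformalRange A) := by
  intro z hz
  by_contra hzcl
  obtain ⟨c, hc, hball⟩ := Metric.mem_nhds_iff.1 (isClosed_closure.isOpen_compl.mem_nhds hzcl)
  have hdist (w : ℂ) (hw : w ∈ conformalRange A) : c ≤ ‖z - w‖ := by
    by_contra! hlt
    rw [← dist_eq_norm, dist_comm] at hlt
    exact hball (Metric.mem_ball.2 hlt) (subset_closure hw)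
  have hbelow (x : K) : c * ‖x‖ ≤ ‖(algebraMap ℂ (K →L[ℂ] K) z - A) x‖ := by
    rcases eq_or_ne x 0 with rfl | hx
    · simp
    obtain ⟨w, hw, hle⟩ := exists_mem_conformalRange_norm_sub_le A hx z
    refine le_trans (by gcongr; exact hdist w hw) (hle.trans_eq ?_)
    simp [Algebra.algebraMap_eq_smul_one]
  have hcl : algebraMap ℂ (K →L[ℂ] K) z - A ∈ closure {S | IsUnit S} := by
    refine map_mem_closure (f := fun w => algebraMap ℂ (K →L[ℂ] K) w - A) (by fun_prop)
      (frontier_eq_closure_inter_closure.subset hz).2 fun w hw => ?_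
    exact spectrum.notMem_iff.1 hw
  exact spectrum.mem_iff.1 ((spectrum.isClosed A).frontier_subset hz)
    (isUnit_of_mem_closure_isUnit_of_le_norm hc hbelow hcl)

theorem spectrum_subset_of_conformalRange_subset (hA : IsUnit A) {r : ℝ}
    (h : conformalRange A ⊆ Complex.exp '' Metric.closedBall 0 r) :
    spectrum ℂ A ⊆ Complex.exp '' Metric.closedBall 0 r := by
  have hclosed : IsClosed (Complex.exp '' Metric.closedBall 0 r) :=
    ((isCompact_closedBall 0 r).image Complex.continuous_exp).isClosed
  exact subset_exp_image_closedBall_of_frontier_subset (spectrum.isCompact A)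
    (spectrum.zero_notMem ℂ hA)
    ((frontier_spectrum_subset_closure_conformalRange A).trans (closure_minimal h hclosed))

end SpectrumConformalRange

section AlgebraicLogarithm

theorem map_ringInverse_of_isUnit {M N F : Type*} [MonoidWithZero M] [MonoidWithZero N]
    [FunLike F M N] [MonoidHomClass F M N] (f : F) {a : M} (ha : IsUnit a) :
    f (Ring.inverse a) = Ring.inverse (f a) := by
  obtain ⟨u, rfl⟩ := ha
  have hu : f ↑u = (Units.map (f : M →* N) u : N) := rfl
  rw [Ring.inverse_unit, hu, Ring.inverse_unit, ← map_inv]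
  rfl

namespace LogWellDefined

variable {𝔄 : Type*} [NormedRing 𝔄] [NormedAlgebra ℝ 𝔄] {a : 𝔄}

theorem isUnit (ha : LogWellDefined a) {s : ℝ} (hs : s ∈ Icc (0 : ℝ) 1) :
    IsUnit (s • (1 : 𝔄) + (1 - s) • a) := by
  have h := ha (1 - s) ⟨sub_nonneg.2 hs.2, sub_le_self 1 hs.1⟩
  rwa [sub_sub_cancel] at h

theorem continuousOn_integrand [CompleteSpace 𝔄] (ha : LogWellDefined a) :
    ContinuousOn (fun s : ℝ => (a - 1) * Ring.inverse (s • (1 : 𝔄) + (1 - s) • a)) (Icc 0 1) := by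
  refine continuousOn_const.mul fun s hs => ContinuousAt.continuousWithinAt ?_
  obtain ⟨u, hu⟩ := ha.isUnit hs
  have hinv : ContinuousAt Ring.inverse (s • (1 : 𝔄) + (1 - s) • a) :=
    hu ▸ NormedRing.inverse_continuousAt u
  exact hinv.comp (f := fun s : ℝ => s • (1 : 𝔄) + (1 - s) • a)
    (Continuous.continuousAt (by fun_prop))

end LogWellDefined

theorem map_algLog {𝔄 𝔅 : Type*} [NormedRing 𝔄] [NormedAlgebra ℝ 𝔄] [CompleteSpace 𝔄]
    [NormedRing 𝔅] [NormedAlgebra ℝ 𝔅] [CompleteSpace 𝔅] (F : 𝔄 →ₐ[ℝ] 𝔅) (hF : Continuous F)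
    {a : 𝔄} (ha : LogWellDefined a) : F (algLog a) = algLog (F a) := by
  refine (ContinuousLinearMap.intervalIntegral_comp_comm (⟨F.toLinearMap, hF⟩ : 𝔄 →L[ℝ] 𝔅)
    (ha.continuousOn_integrand.intervalIntegrable_of_Icc zero_le_one)).symm.trans
    (intervalIntegral.integral_congr fun s hs => ?_)
  rw [uIcc_of_le zero_le_one] at hs
  change F ((a - 1) * Ring.inverse (s • (1 : 𝔄) + (1 - s) • a)) = _
  simp only [map_mul, map_sub, map_one, map_ringInverse_of_isUnit F (ha.isUnit hs), map_add,
    map_smul]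

theorem algLog_eq_log {z : ℂ} (hz : z ∈ Complex.slitPlane) : algLog z = Complex.log z := by
  have h := Complex.log_eq_integral (z := z - 1) (by rwa [add_sub_cancel])
  rw [add_sub_cancel] at h
  rw [algLog, intervalIntegral.integral_const_mul, h]
  congr 1
  have hsub := intervalIntegral.integral_comp_sub_left (a := 0) (b := 1)
    (fun t : ℝ => (1 + t • (z - 1))⁻¹) 1
  rw [sub_self, sub_zero] at hsub
  rw [← hsub]
  refine intervalIntegral.integral_congr fun s _ => ?_
  rw [Ring.inverse_eq_inv']
  congr 1
  module

end AlgebraicLogarithm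

section SpectrumAlgLog

theorem logWellDefined_of_spectrum_subset_slitPlane {𝔅 : Type*} [NormedRing 𝔅] [NormedAlgebra ℂ 𝔅]
    {b : 𝔅} (hb : spectrum ℂ b ⊆ Complex.slitPlane) : LogWellDefined b := by
  intro t ht
  rcases ht.1.eq_or_lt with rfl | ht0
  · simp
  have ht0' : (t : ℂ) ≠ 0 := Complex.ofReal_ne_zero.2 ht0.ne'
  have hnotMem : ((-((1 - t) / t) : ℝ) : ℂ) ∉ spectrum ℂ b := fun hmem => by
    have hneg := Complex.ofReal_mem_slitPlane.1 (hb hmem)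
    linarith [div_nonneg (sub_nonneg.2 ht.2) ht0.le]
  have hunit := (spectrum.notMem_iff.1 hnotMem).smul (Units.mk0 _ (neg_ne_zero.2 ht0'))
  convert hunit using 1
  rw [Units.smul_mk0, smul_sub, neg_smul _ b, sub_neg_eq_add, Algebra.algebraMap_eq_smul_one,
    smul_smul, ← Complex.coe_smul, ← Complex.coe_smul]
  congr 2
  push_cast
  field_simp

theorem spectrum_algLog_subset_of_commRing {A : Type*} [NormedCommRing A] [NormedAlgebra ℂ A]
    [CompleteSpace A] {a : A} (ha : spectrum ℂ a ⊆ Complex.slitPlane) :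
    spectrum ℂ (algLog a) ⊆ Complex.log '' spectrum ℂ a := by
  intro z hz
  obtain ⟨χ, rfl⟩ := WeakDual.CharacterSpace.mem_spectrum_iff_exists.1 hz
  have hmem : χ a ∈ spectrum ℂ a := WeakDual.CharacterSpace.mem_spectrum_iff_exists.2 ⟨χ, rfl⟩
  refine ⟨χ a, hmem, ?_⟩
  rw [← algLog_eq_log (ha hmem)]
  exact (map_algLog ((WeakDual.CharacterSpace.toAlgHom χ).restrictScalars ℝ) (map_continuous χ)
    (logWellDefined_of_spectrum_subset_slitPlane ha)).symm

theorem spectrum_coe_centralizer {R A : Type*} [CommRing R] [Ring A] [Algebra R A] {S : Set A}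
    (b : Subalgebra.centralizer R S) : spectrum R (b : A) = spectrum R b := by
  refine (AlgHom.spectrum_apply_subset (Subalgebra.val _) b).antisymm fun z hz hunit => hz ?_
  obtain ⟨u, hu⟩ : IsUnit (algebraMap R A z - b) := hunit
  have hu_mem : (u : A) ∈ Subalgebra.centralizer R S :=
    hu ▸ sub_mem (Subalgebra.algebraMap_mem _ z) b.2
  have hinv_mem : (↑u⁻¹ : A) ∈ Subalgebra.centralizer R S := fun g hg =>
    Commute.units_inv_right (hu_mem g hg)
  have hinv : (algebraMap R _ z - b) * (⟨↑u⁻¹, hinv_mem⟩ : Subalgebra.centralizer R S) = 1 :=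
    Subtype.ext (by rw [MulMemClass.coe_mul, AddSubgroupClass.coe_sub]; exact hu ▸ u.mul_inv)
  have hinv' : (⟨↑u⁻¹, hinv_mem⟩ : Subalgebra.centralizer R S) * (algebraMap R _ z - b) = 1 :=
    Subtype.ext (by rw [MulMemClass.coe_mul, AddSubgroupClass.coe_sub]; exact hu ▸ u.inv_mul)
  exact ⟨⟨_, _, hinv, hinv'⟩, rfl⟩

variable {𝔅 : Type*} [NormedRing 𝔅] [NormedAlgebra ℂ 𝔅] [CompleteSpace 𝔅] {b : 𝔅}

/- The double commutant of `b` is a commutative Banach algebra in which `b` has the same spectrum,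
so that its characters compute the spectrum of `algLog b`. -/
theorem spectrum_algLog_subset (hb : spectrum ℂ b ⊆ Complex.slitPlane) :
    spectrum ℂ (algLog b) ⊆ Complex.log '' spectrum ℂ b := by
  let C : Subalgebra ℂ 𝔅 := Subalgebra.centralizer ℂ (centralizer {b})
  let _ : NormedCommRing C :=
    { (inferInstance : NormedRing C) with
      mul_comm := fun x y => Subtype.ext <|
        centralizer_centralizer_comm_of_comm (S := {b}) (by rintro _ rfl _ rfl; rfl) x x.2 y y.2 }
  have : CompleteSpace C := (Set.isClosed_centralizer _).completeSpace_coe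
  let c : C := ⟨b, subset_centralizer_centralizer (mem_singleton b)⟩
  have hspec : spectrum ℂ b = spectrum ℂ c := spectrum_coe_centralizer c
  rw [hspec] at hb ⊢
  have halgLog : C.val (algLog c) = algLog b := map_algLog (C.val.restrictScalars ℝ)
    continuous_subtype_val (logWellDefined_of_spectrum_subset_slitPlane hb)
  rw [← halgLog]
  exact (AlgHom.spectrum_apply_subset C.val _).trans (spectrum_algLog_subset_of_commRing hb)

theorem abs_im_lt_pi_of_mem_closedBall {r : ℝ} (hr : r < Real.pi) {w : ℂ}
    (hw : w ∈ Metric.closedBall 0 r) : |w.im| < Real.pi :=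
  (Complex.abs_im_le_norm w).trans_lt ((mem_closedBall_zero_iff.1 hw).trans_lt hr)

theorem exp_image_closedBall_subset_slitPlane {r : ℝ} (hr : r < Real.pi) :
    Complex.exp '' Metric.closedBall 0 r ⊆ Complex.slitPlane := by
  rintro _ ⟨w, hw, rfl⟩
  obtain ⟨him, him'⟩ := abs_lt.1 (abs_im_lt_pi_of_mem_closedBall hr hw)
  rw [Complex.mem_slitPlane_iff_arg, ← Complex.log_im, Complex.log_exp him him'.le]
  exact ⟨him'.ne, Complex.exp_ne_zero w⟩

theorem spectrum_algLog_subset_closedBall {r : ℝ} (hr : r < Real.pi)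
    (hb : spectrum ℂ b ⊆ Complex.exp '' Metric.closedBall 0 r) :
    spectrum ℂ (algLog b) ⊆ Metric.closedBall 0 r := by
  intro z hz
  obtain ⟨y, hy, rfl⟩ :=
    spectrum_algLog_subset (hb.trans (exp_image_closedBall_subset_slitPlane hr)) hz
  obtain ⟨w, hw, rfl⟩ := hb hy
  obtain ⟨him, him'⟩ := abs_lt.1 (abs_im_lt_pi_of_mem_closedBall hr hw)
  rwa [Complex.log_exp him him'.le]

theorem spectralRadius_le_of_spectrum_subset_closedBall {A : Type*} [Ring A] [Algebra ℂ A] {a : A}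
    {R : ENNReal} (ha : spectrum ℂ a ⊆ Metric.closedBall 0 R.toReal) :
    spectralRadius ℂ a ≤ R := by
  refine iSup₂_le fun z hz => ?_
  rw [← enorm_eq_nnnorm, ← ofReal_norm]
  exact ENNReal.ofReal_le_of_le_toReal (mem_closedBall_zero_iff.1 (ha hz))

end SpectrumAlgLog

/-- The complexification `H ⊕ iH` of a real Hilbert space `H`, in which the spectra of operators on
`H` are computed. The vector `x + iy` is the pair `(x, y)` in the `L²` product of `H` with
itself. -/
def Complexification (H : Type*) : Type _ := WithLp 2 (H × H)

namespace Complexification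

variable {H : Type*}

/-- The vector `x + iy`. -/
def mk (x y : H) : Complexification H := WithLp.toLp 2 (x, y)

/-- The real part `x` of `x + iy`. -/
def re (v : Complexification H) : H := WithLp.fst v

/-- The imaginary part `y` of `x + iy`. -/
def im (v : Complexification H) : H := WithLp.snd v

@[simp] theorem re_mk (x y : H) : (mk x y).re = x := rfl
@[simp] theorem im_mk (x y : H) : (mk x y).im = y := rfl

@[ext] theorem ext {v w : Complexification H} (hre : v.re = w.re) (him : v.im = w.im) : v = w :=
  (WithLp.equiv 2 (H × H)).injective (Prod.ext hre him)

variable [NormedAddCommGroup H]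

noncomputable instance : NormedAddCommGroup (Complexification H) :=
  inferInstanceAs (NormedAddCommGroup (WithLp 2 (H × H)))

instance [CompleteSpace H] : CompleteSpace (Complexification H) :=
  inferInstanceAs (CompleteSpace (WithLp 2 (H × H)))

@[simp] theorem re_zero : (0 : Complexification H).re = 0 := rfl
@[simp] theorem im_zero : (0 : Complexification H).im = 0 := rfl
@[simp] theorem re_add (v w : Complexification H) : (v + w).re = v.re + w.re := rfl
@[simp] theorem im_add (v w : Complexification H) : (v + w).im = v.im + w.im := rfl

theorem norm_sq_eq (v : Complexification H) : ‖v‖ ^ 2 = ‖v.re‖ ^ 2 + ‖v.im‖ ^ 2 :=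
  WithLp.prod_norm_sq_eq_of_L2 v

theorem norm_mk_le {x y : H} {v : Complexification H} {C : ℝ} (hC : 0 ≤ C)
    (hx : ‖x‖ ≤ C * ‖v.re‖) (hy : ‖y‖ ≤ C * ‖v.im‖) : ‖mk x y‖ ≤ C * ‖v‖ := by
  rw [← sq_le_sq₀ (norm_nonneg _) (by positivity), mul_pow, norm_sq_eq, norm_sq_eq, mul_add,
    ← mul_pow, ← mul_pow]
  exact add_le_add (pow_le_pow_left₀ (norm_nonneg _) hx 2) (pow_le_pow_left₀ (norm_nonneg _) hy 2)

theorem norm_re_le (v : Complexification H) : ‖v.re‖ ≤ ‖v‖ := by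
  rw [← sq_le_sq₀ (norm_nonneg _) (norm_nonneg _), norm_sq_eq]
  exact le_add_of_nonneg_right (sq_nonneg _)

theorem norm_im_le (v : Complexification H) : ‖v.im‖ ≤ ‖v‖ := by
  rw [← sq_le_sq₀ (norm_nonneg _) (norm_nonneg _), norm_sq_eq]
  exact le_add_of_nonneg_left (sq_nonneg _)

variable [InnerProductSpace ℝ H]

instance : SMul ℂ (Complexification H) where
  smul z v := mk (z.re • v.re - z.im • v.im) (z.re • v.im + z.im • v.re)

@[simp] theorem re_smul (z : ℂ) (v : Complexification H) :
    (z • v).re = z.re • v.re - z.im • v.im := rfl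

@[simp] theorem im_smul (z : ℂ) (v : Complexification H) :
    (z • v).im = z.re • v.im + z.im • v.re := rfl

noncomputable instance : Module ℂ (Complexification H) where
  one_smul v := by ext <;> simp
  mul_smul z w v := by
    ext <;> simp only [re_smul, im_smul, Complex.mul_re, Complex.mul_im] <;> module
  smul_zero z := by ext <;> simp
  smul_add z v w := by ext <;> simp only [re_smul, im_smul, re_add, im_add] <;> module
  add_smul z w v := by
    ext <;> simp only [re_smul, im_smul, re_add, im_add, Complex.add_re, Complex.add_im] <;> module
  zero_smul v := by ext <;> simp

noncomputable instance : NormedSpace ℂ (Complexification H) where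
  norm_smul_le z v := by
    refine le_of_eq ((sq_eq_sq₀ (norm_nonneg _) (by positivity)).1 ?_)
    rw [mul_pow, norm_sq_eq, norm_sq_eq, Complex.sq_norm, Complex.normSq_apply, re_smul, im_smul,
      norm_sub_sq_real, norm_add_sq_real]
    simp only [inner_smul_left, inner_smul_right, norm_smul, mul_pow, Real.norm_eq_abs, sq_abs,
      conj_trivial, real_inner_comm v.re v.im]
    ring

noncomputable instance : InnerProductSpace ℂ (Complexification H) where
  inner v w := ⟨inner ℝ v.re w.re + inner ℝ v.im w.im, inner ℝ v.re w.im - inner ℝ v.im w.re⟩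
  norm_sq_eq_re_inner v := by
    rw [norm_sq_eq, ← real_inner_self_eq_norm_sq, ← real_inner_self_eq_norm_sq]
    rfl
  conj_inner_symm v w := by
    apply Complex.ext <;> simp [real_inner_comm]
  add_left u v w := by
    apply Complex.ext <;> simp only [re_add, im_add, inner_add_left, Complex.add_re,
      Complex.add_im] <;> ring
  smul_left v w z := by
    apply Complex.ext <;> simp only [re_smul, im_smul, inner_add_left, inner_sub_left,
      inner_smul_left, conj_trivial, Complex.mul_re, Complex.mul_im, Complex.conj_re,
      Complex.conj_im] <;> ring

@[simp] theorem re_real_smul (r : ℝ) (v : Complexification H) : (r • v).re = r • v.re := by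
  rw [← Complex.coe_smul, re_smul, Complex.ofReal_re, Complex.ofReal_im, zero_smul, sub_zero]

@[simp] theorem im_real_smul (r : ℝ) (v : Complexification H) : (r • v).im = r • v.im := by
  rw [← Complex.coe_smul, im_smul, Complex.ofReal_re, Complex.ofReal_im, zero_smul, add_zero]

/-- The complex-linear extension `x + iy ↦ T x + i T y` of operators, as an embedding of the real
operator algebra of `H` into the complex operator algebra of its complexification. -/
noncomputable def extend : (H →L[ℝ] H) →ₐ[ℝ] (Complexification H →L[ℂ] Complexification H) where
  toFun T := LinearMap.mkContinuous
    { toFun := fun v => mk (T v.re) (T v.im)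
      map_add' := fun v w => by ext <;> simp
      map_smul' := fun z v => by ext <;> simp } ‖T‖
    fun _ => norm_mk_le (norm_nonneg T) (T.le_opNorm _) (T.le_opNorm _)
  map_one' := rfl
  map_mul' S T := rfl
  map_zero' := rfl
  map_add' S T := rfl
  commutes' r := by
    ext v <;> simp [Algebra.algebraMap_eq_smul_one]

theorem norm_extend_apply_le (T : H →L[ℝ] H) (v : Complexification H) :
    ‖extend T v‖ ≤ ‖T‖ * ‖v‖ :=
  norm_mk_le (norm_nonneg T) (T.le_opNorm _) (T.le_opNorm _)

theorem continuous_extend : Continuous (extend (H := H)) :=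
  AddMonoidHomClass.continuous_of_bound extend 1 fun T => by
    rw [one_mul]
    exact ContinuousLinearMap.opNorm_le_bound _ (norm_nonneg T) (norm_extend_apply_le T)

theorem isUnit_of_isUnit_extend [CompleteSpace H] {T : H →L[ℝ] H} (hT : IsUnit (extend T)) :
    IsUnit T := by
  rw [ContinuousLinearMap.isUnit_iff_bijective] at hT ⊢
  refine ⟨fun x y hxy => ?_, fun y => ?_⟩
  · exact congrArg re (hT.1 (a₁ := mk x 0) (a₂ := mk y 0) (ext hxy rfl))
  · obtain ⟨v, hv⟩ := hT.2 (mk y 0)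
    exact ⟨v.re, congrArg re hv⟩

theorem _root_.LogWellDefined.of_extend [CompleteSpace H] {T : H →L[ℝ] H}
    (hT : LogWellDefined (extend T)) : LogWellDefined T := fun t ht =>
  isUnit_of_isUnit_extend (by rw [map_add, map_smul, map_smul, map_one]; exact hT t ht)

/-- The canonical homomorphism from the complexified operator algebra of `H` to the operator algebra
of the complexified space. -/
noncomputable def liftExtend :
    ℂ ⊗[ℝ] (H →L[ℝ] H) →ₐ[ℂ] (Complexification H →L[ℂ] Complexification H) :=
  AlgHom.liftEquiv ℝ ℂ _ _ extend

@[simp] theorem liftExtend_tmul (z : ℂ) (T : H →L[ℝ] H) : liftExtend (z ⊗ₜ[ℝ] T) = z • extend T :=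
  AlgHom.liftEquiv_tmul ..

/-- The real part as a bounded operator. -/
noncomputable def reCLM : Complexification H →L[ℝ] H :=
  LinearMap.mkContinuous ⟨⟨re, re_add⟩, re_real_smul⟩ 1 fun v => by
    rw [one_mul]
    exact norm_re_le v

/-- The imaginary part as a bounded operator. -/
noncomputable def imCLM : Complexification H →L[ℝ] H :=
  LinearMap.mkContinuous ⟨⟨im, im_add⟩, im_real_smul⟩ 1 fun v => by
    rw [one_mul]
    exact norm_im_le v

/-- The embedding `x ↦ x + i0` as a bounded operator. -/
noncomputable def inlCLM : H →L[ℝ] Complexification H :=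
  LinearMap.mkContinuous
    { toFun := fun x => mk x 0
      map_add' := fun x y => by ext <;> simp
      map_smul' := fun r x => by ext <;> simp } 1 fun x => by
    rw [one_mul, ← sq_le_sq₀ (norm_nonneg _) (norm_nonneg _), norm_sq_eq]
    simp

/-- The operator `A` on `H` for which an operator on the complexification is `A + iB`. -/
noncomputable def reBlock (S : Complexification H →L[ℂ] Complexification H) : H →L[ℝ] H :=
  reCLM ∘L S.restrictScalars ℝ ∘L inlCLM

/-- The operator `B` on `H` for which an operator on the complexification is `A + iB`. -/
noncomputable def imBlock (S : Complexification H →L[ℂ] Complexification H) : H →L[ℝ] H :=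
  imCLM ∘L S.restrictScalars ℝ ∘L inlCLM

/-- The element `1 ⊗ A + i ⊗ B` of the complexified operator algebra of `H` attached to an operator
`A + iB` on the complexification; it is the inverse of `liftExtend`. -/
noncomputable def ofBlocks (S : Complexification H →L[ℂ] Complexification H) :
    ℂ ⊗[ℝ] (H →L[ℝ] H) :=
  1 ⊗ₜ reBlock S + Complex.I ⊗ₜ imBlock S

theorem ofBlocks_add (S S' : Complexification H →L[ℂ] Complexification H) :
    ofBlocks (S + S') = ofBlocks S + ofBlocks S' := by
  have hre : reBlock (S + S') = reBlock S + reBlock S' := rfl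
  have him : imBlock (S + S') = imBlock S + imBlock S' := rfl
  rw [ofBlocks, hre, him, TensorProduct.tmul_add, TensorProduct.tmul_add, add_add_add_comm,
    ofBlocks, ofBlocks]

theorem ofBlocks_smul_extend (z : ℂ) (T : H →L[ℝ] H) : ofBlocks (z • extend T) = z ⊗ₜ T := by
  have hre : reBlock (z • extend T) = z.re • T := by
    ext x
    change z.re • T x - z.im • T 0 = z.re • T x
    rw [map_zero, smul_zero, sub_zero]
  have him : imBlock (z • extend T) = z.im • T := by
    ext x
    change z.re • T 0 + z.im • T x = z.im • T x
    rw [map_zero, smul_zero, zero_add]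
  rw [ofBlocks, hre, him, ← TensorProduct.smul_tmul, ← TensorProduct.smul_tmul,
    ← TensorProduct.add_tmul, Complex.real_smul, Complex.real_smul, mul_one, Complex.re_add_im]

theorem ofBlocks_liftExtend (a : ℂ ⊗[ℝ] (H →L[ℝ] H)) : ofBlocks (liftExtend a) = a := by
  induction a with
  | zero => simpa using ofBlocks_smul_extend (0 : ℂ) (0 : H →L[ℝ] H)
  | tmul z T => rw [liftExtend_tmul, ofBlocks_smul_extend]
  | add a b ha hb => rw [map_add, ofBlocks_add, ha, hb]

theorem liftExtend_ofBlocks (S : Complexification H →L[ℂ] Complexification H) :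
    liftExtend (ofBlocks S) = S := by
  ext1 v
  have hv : v = mk v.re 0 + Complex.I • mk v.im 0 := by ext <;> simp
  have hS : S v = S (mk v.re 0) + Complex.I • S (mk v.im 0) := by
    rw [← map_smul, ← map_add, ← hv]
  rw [ofBlocks, map_add, liftExtend_tmul, liftExtend_tmul, one_smul, hS]
  ext
  · change (S (mk v.re 0)).re + ((0 : ℝ) • _ - (1 : ℝ) • (S (mk v.im 0)).im) = _
    simp
  · change (S (mk v.im 0)).re + ((0 : ℝ) • _ + (1 : ℝ) • (S (mk v.re 0)).im) = _
    simp [add_comm]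

theorem spectrum_complexify (T : H →L[ℝ] H) :
    spectrum ℂ (complexify T) = spectrum ℂ (extend T) := by
  have hbij : Function.Bijective (liftExtend (H := H)) :=
    ⟨Function.LeftInverse.injective ofBlocks_liftExtend,
      Function.RightInverse.surjective liftExtend_ofBlocks⟩
  rw [← AlgEquiv.spectrum_eq (AlgEquiv.ofBijective liftExtend hbij) (complexify T)]
  congr 1
  exact (liftExtend_tmul 1 T).trans (one_smul ℂ _)

end Complexification

section OperatorLexp

variable {α H : Type*} [LinearOrder α] [TopologicalSpace α] [OrderClosedTopology α]
  [SecondCountableTopology α] [MeasurableSpace α] [BorelSpace α] [NormedAddCommGroup H]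
  [CompleteSpace H]

section Complex

variable [InnerProductSpace ℂ H] {φ : VectorMeasure α (H →L[ℂ] H)}

theorem spectrum_Lexp_subset (hφ : totalVariation φ < ⊤) (hatom : ∀ t, φ {t} = 0) :
    spectrum ℂ (Lexp φ) ⊆ Complex.exp '' Metric.closedBall 0 (totalVariation φ).toReal :=
  spectrum_subset_of_conformalRange_subset (isUnit_Lexp hφ hatom)
    (conformalRange_map_Lexp_subset hφ hatom (RingHom.id _) fun A => A.le_opNorm)

theorem logWellDefined_Lexp (hφ : totalVariation φ < ⊤) (hatom : ∀ t, φ {t} = 0)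
    (hpi : (totalVariation φ).toReal < Real.pi) : LogWellDefined (Lexp φ) :=
  logWellDefined_of_spectrum_subset_slitPlane
    ((spectrum_Lexp_subset hφ hatom).trans (exp_image_closedBall_subset_slitPlane hpi))

theorem spectralRadius_algLog_Lexp_le (hφ : totalVariation φ < ⊤) (hatom : ∀ t, φ {t} = 0)
    (hpi : (totalVariation φ).toReal < Real.pi) :
    spectralRadius ℂ (algLog (Lexp φ)) ≤ totalVariation φ :=
  spectralRadius_le_of_spectrum_subset_closedBall
    (spectrum_algLog_subset_closedBall hpi (spectrum_Lexp_subset hφ hatom))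

end Complex

section Real

variable [InnerProductSpace ℝ H] {φ : VectorMeasure α (H →L[ℝ] H)}

theorem spectrum_extend_Lexp_subset (hφ : totalVariation φ < ⊤) (hatom : ∀ t, φ {t} = 0) :
    spectrum ℂ (Complexification.extend (Lexp φ)) ⊆
      Complex.exp '' Metric.closedBall 0 (totalVariation φ).toReal :=
  spectrum_subset_of_conformalRange_subset
    ((isUnit_Lexp hφ hatom).map Complexification.extend)
    (conformalRange_map_Lexp_subset hφ hatom Complexification.extend.toRingHom
      Complexification.norm_extend_apply_le)

theorem spectrum_complexify_Lexp_subset (hφ : totalVariation φ < ⊤) (hatom : ∀ t, φ {t} = 0) :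
    spectrum ℂ (complexify (Lexp φ)) ⊆
      Complex.exp '' Metric.closedBall 0 (totalVariation φ).toReal :=
  (Complexification.spectrum_complexify _).trans_subset (spectrum_extend_Lexp_subset hφ hatom)

theorem logWellDefined_Lexp_of_real (hφ : totalVariation φ < ⊤) (hatom : ∀ t, φ {t} = 0)
    (hpi : (totalVariation φ).toReal < Real.pi) : LogWellDefined (Lexp φ) :=
  LogWellDefined.of_extend (logWellDefined_of_spectrum_subset_slitPlane
    ((spectrum_extend_Lexp_subset hφ hatom).trans (exp_image_closedBall_subset_slitPlane hpi)))

theorem spectralRadius_complexify_algLog_Lexp_le (hφ : totalVariation φ < ⊤)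
    (hatom : ∀ t, φ {t} = 0) (hpi : (totalVariation φ).toReal < Real.pi) :
    spectralRadius ℂ (complexify (algLog (Lexp φ))) ≤ totalVariation φ := by
  refine spectralRadius_le_of_spectrum_subset_closedBall ?_
  rw [Complexification.spectrum_complexify, map_algLog _ Complexification.continuous_extend
    (logWellDefined_Lexp_of_real hφ hatom hpi)]
  exact spectrum_algLog_subset_closedBall hpi (spectrum_extend_Lexp_subset hφ hatom)

end Real

end OperatorLexp

theorem mainTheorem1_general {α : Type*} [LinearOrder α] [TopologicalSpace α]
    [OrderClosedTopology α] [SecondCountableTopology α] [MeasurableSpace α] [BorelSpace α] :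
    (∀ (H : Type*) [NormedAddCommGroup H] [InnerProductSpace ℂ H] [CompleteSpace H]
        (φ : VectorMeasure α (H →L[ℂ] H)), totalVariation φ < ⊤ → (∀ t, φ {t} = 0) →
      conformalRange (Lexp φ) ⊆ Complex.exp '' Metric.closedBall 0 (totalVariation φ).toReal ∧
      spectrum ℂ (Lexp φ) ⊆ Complex.exp '' Metric.closedBall 0 (totalVariation φ).toReal ∧
      ((totalVariation φ).toReal < Real.pi →
        LogWellDefined (Lexp φ) ∧
        spectralRadius ℂ (algLog (Lexp φ)) ≤ totalVariation φ)) ∧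
    (∀ (H : Type*) [NormedAddCommGroup H] [InnerProductSpace ℝ H] [CompleteSpace H]
        (φ : VectorMeasure α (H →L[ℝ] H)), totalVariation φ < ⊤ → (∀ t, φ {t} = 0) →
      conformalRange (Lexp φ) ⊆ Complex.exp '' Metric.closedBall 0 (totalVariation φ).toReal ∧
      spectrum ℂ (complexify (Lexp φ)) ⊆
        Complex.exp '' Metric.closedBall 0 (totalVariation φ).toReal ∧
      ((totalVariation φ).toReal < Real.pi →
        LogWellDefined (Lexp φ) ∧
        spectralRadius ℂ (complexify (algLog (Lexp φ))) ≤ totalVariation φ)) :=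
  ⟨fun _ _ _ _ _ hφ hatom =>
    ⟨conformalRange_map_Lexp_subset hφ hatom (RingHom.id _) fun A => A.le_opNorm,
      spectrum_Lexp_subset hφ hatom, fun hpi =>
      ⟨logWellDefined_Lexp hφ hatom hpi, spectralRadius_algLog_Lexp_le hφ hatom hpi⟩⟩,
    fun _ _ _ _ _ hφ hatom =>
    ⟨conformalRange_map_Lexp_subset hφ hatom (RingHom.id _) fun A => A.le_opNorm,
      spectrum_complexify_Lexp_subset hφ hatom, fun hpi =>
      ⟨logWellDefined_Lexp_of_real hφ hatom hpi,
        spectralRadius_complexify_algLog_Lexp_le hφ hatom hpi⟩⟩⟩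

theorem mainTheorem1 (I : Set ℝ) (hI : I.OrdConnected) :
    -- complex Hilbert spaces
    (∀ (H : Type*) [NormedAddCommGroup H] [InnerProductSpace ℂ H] [CompleteSpace H]
        (φ : VectorMeasure I (H →L[ℂ] H)), totalVariation φ < ⊤ → (∀ t : I, φ {t} = 0) →
      conformalRange (Lexp φ) ⊆ Complex.exp '' Metric.closedBall 0 (totalVariation φ).toReal ∧
      spectrum ℂ (Lexp φ) ⊆ Complex.exp '' Metric.closedBall 0 (totalVariation φ).toReal ∧
      ((totalVariation φ).toReal < Real.pi →
        LogWellDefined (Lexp φ) ∧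
        spectralRadius ℂ (algLog (Lexp φ)) ≤ totalVariation φ)) ∧
    -- real Hilbert spaces, with spectra taken in the complexification
    (∀ (H : Type*) [NormedAddCommGroup H] [InnerProductSpace ℝ H] [CompleteSpace H]
        (φ : VectorMeasure I (H →L[ℝ] H)), totalVariation φ < ⊤ → (∀ t : I, φ {t} = 0) →
      conformalRange (Lexp φ) ⊆ Complex.exp '' Metric.closedBall 0 (totalVariation φ).toReal ∧
      spectrum ℂ (complexify (Lexp φ)) ⊆
        Complex.exp '' Metric.closedBall 0 (totalVariation φ).toReal ∧
      ((totalVariation φ).toReal < Real.pi →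
        LogWellDefined (Lexp φ) ∧
        spectralRadius ℂ (complexify (algLog (Lexp φ))) ≤ totalVariation φ)) :=
  mainTheorem1_general
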